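/- A cylindric partition with profile $c=(c_1,\dots,c_r)$, where the $c_i$ are nonnegative integers, is a tuple $\Lambda=(\lambda^{(1)},\dots,\lambda^{(r)})$ of ordinary partitions $\lambda^{(i)}=(\lambda^{(i)}_1\ge\lambda^{(i)}_2\ge\cdots)$, each extended by infinitely many zeros, such that $\lambda^{(i)}_j\ge\lambda^{(i+1)}_{j+c_{i+1}}$ for $1\le i<r$ and $\lambda^{(r)}_j\ge\lambda^{(1)}_{j+c_1}$, for all $j\ge1$. Its size $|\Lambda|$ is the sum of all parts of all $\lambda^{(i)}$. Let $P_c$ be the set of cylindric partitions with profile $c$, and write $(a;q)_n=\prod_{k=1}^n(1-aq^{k-1})$ and $(a;q)_\infty=\lim_{n\to\infty}(a;q)_n$. Theorem. For every complex $q$ with $|q|<1$, the series $\sum_{n\ge0} q^{n^2}/(q^4;q^4)_n$ converges absolutely, the generating function of cylindric partitions with profile $c=(1,1,0)$ (rank 3, level 2) converges absolutely, and $$\sum_{\Lambda\in P_{(1,1,0)}}q^{|\Lambda|}=\left(\sum_{n\ge0}\frac{q^{n^2}}{(q^4;q^4)_n}\right)\cdot\frac{(-q^2;q^2)_\infty}{(q;q)_\infty}.$$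 The generating function $\sum_{\Lambda\in P_{(2,1)}}q^{|\Lambda|}$ of cylindric partitions with profile $(2,1)$ (rank 2, level 3) also converges absolutely and has the same value. -/

import Mathlib

open Filter Topology

/-- A cylindric partition with profile `c = (c₁, …, c_r)` (indexed here by `Fin r`, cyclically).
Each component is an ordinary partition: a weakly decreasing sequence of natural numbers
with finitely many nonzero terms, i.e. its parts followed by zeros. Since addition in `Fin r`
is cyclic, `interlace` also contains the wrap-around condition from the last row to the first. -/
@[ext]
structure CylindricPartition {r : ℕ} [NeZero r] (c : Fin r → ℕ) where
  /-- `row i j` is the `j`-th part of the `i`-th partition (both counted from zero). -/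
  row : Fin r → ℕ →₀ ℕ
  antitone_row : ∀ i, Antitone (row i)
  interlace : ∀ (i : Fin r) (j : ℕ), row (i + 1) (j + c (i + 1)) ≤ row i j

/-- The size of a cylindric partition: the sum of all parts of all its rows. -/
def CylindricPartition.size {r : ℕ} [NeZero r] {c : Fin r → ℕ}
    (L : CylindricPartition c) : ℕ :=
  ∑ i, (L.row i).sum fun _ part => part

/-- The finite `q`-Pochhammer symbol `(a; q)_n = ∏_{k=1}^n (1 - a q^{k-1})`. -/
noncomputable def qPochhammer (a q : ℂ) (n : ℕ) : ℂ :=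
  ∏ k ∈ Finset.range n, (1 - a * q ^ k)

/-- The infinite `q`-Pochhammer symbol `(a; q)_∞ = lim_{n → ∞} (a; q)_n`. -/
noncomputable def qPochhammerInf (a q : ℂ) : ℂ :=
  limUnder atTop (qPochhammer a q)

/-- For `|q| < 1` the limit defining `(a; q)_∞` exists. -/
theorem tendsto_qPochhammer (a : ℂ) {q : ℂ} (hq : ‖q‖ < 1) :
    Tendsto (qPochhammer a q) atTop (𝓝 (qPochhammerInf a q)) := by
  have hs : Summable fun k : ℕ => ‖-(a * q ^ k)‖ := by
    simp only [norm_neg, norm_mul, norm_pow]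
    exact (summable_geometric_of_lt_one (norm_nonneg q) hq).mul_left ‖a‖
  have hm := (multipliable_one_add_of_summable hs).hasProd.tendsto_prod_nat
  simp only [← sub_eq_add_neg] at hm
  exact tendsto_nhds_limUnder ⟨_, hm⟩

/-! Both families are in size-preserving bijection with the same set: sequences `f` with `f (n + 2)
≤ f n` and `f (n + 3) ≤ f n`. Interleaving two rows makes monotonicity step 2 and, for profile
(2,1), interlacing step 3; interleaving three rows for (1,1,0) reverses these roles
(`hasSum_pow_size`).

Such an `f` fails to decrease only between neighbours, at a finite set `S` of ascents with no two
consecutive elements. Swapping each ascending pair sorts `f` into a partition with strict descents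
on `S`; removing one unit of descent at each element of `S` leaves an arbitrary partition. So the
generating function is the sum over gapped sets times `1/(q;q)_∞`, and gapped sets give the
Rogers–Ramanujan sum `∑ q^(n^2)/(q;q)_n`.

Rogers' identity `tsum_rogers` turns that sum into the required one: with `Q = q^2`, expand
`1/(q;q)_N` as a convolution of `1/(Q;Q)_n` and `q^m/(Q;Q)_m`, then sum over `m` by Euler's formula.
-/

/-! ### Basic facts and bounds for q-Pochhammer symbols. -/

theorem qPochhammer_zero (a q : ℂ) : qPochhammer a q 0 = 1 := by
  simp [qPochhammer]

theorem qPochhammer_succ (a q : ℂ) (n : ℕ) :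
    qPochhammer a q (n + 1) = qPochhammer a q n * (1 - a * q ^ n) := by
  simp [qPochhammer, Finset.prod_range_succ]

theorem qPochhammer_add (a q : ℂ) (m n : ℕ) :
    qPochhammer a q (m + n) = qPochhammer a q m * qPochhammer (a * q ^ m) q n := by
  simp [qPochhammer, Finset.prod_range_add, pow_add, mul_assoc]

theorem qPochhammerInf_eq_mul (a : ℂ) {q : ℂ} (hq : ‖q‖ < 1) (m : ℕ) :
    qPochhammerInf a q = qPochhammer a q m * qPochhammerInf (a * q ^ m) q := by
  have h1 := (tendsto_qPochhammer (a * q ^ m) hq).const_mul (qPochhammer a q m)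
  simp only [← qPochhammer_add] at h1
  refine tendsto_nhds_unique ?_ h1
  have := (tendsto_qPochhammer a hq).comp (tendsto_add_atTop_nat m)
  simpa [Function.comp_def, add_comm] using this

theorem qPochhammerInf_ne_zero {a q : ℂ} (hq : ‖q‖ < 1) (h : ∀ k : ℕ, 1 - a * q ^ k ≠ 0) :
    qPochhammerInf a q ≠ 0 := by
  have hs : Summable fun k : ℕ => ‖-(a * q ^ k)‖ := by
    simp only [norm_neg, norm_mul, norm_pow]
    exact (summable_geometric_of_lt_one (norm_nonneg q) hq).mul_left ‖a‖
  have hm := (multipliable_one_add_of_summable hs).hasProd.tendsto_prod_nat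
  have h0 := tprod_one_add_ne_zero_of_summable (fun k => by simpa [sub_eq_add_neg] using h k) hs
  simp only [← sub_eq_add_neg] at hm h0
  rwa [tendsto_nhds_unique (tendsto_qPochhammer a hq) hm]

theorem one_sub_mul_pow_ne_zero {a q : ℂ} (ha : ‖a‖ < 1) (hq : ‖q‖ < 1) (k : ℕ) :
    1 - a * q ^ k ≠ 0 := by
  intro h
  have h1 : ‖a * q ^ k‖ = 1 := by rw [← sub_eq_zero.mp h, norm_one]
  have h2 : ‖q‖ ^ k ≤ 1 := pow_le_one₀ (norm_nonneg q) hq.le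
  rw [norm_mul, norm_pow] at h1
  nlinarith [norm_nonneg a]

theorem qPochhammer_ne_zero {a q : ℂ} (ha : ‖a‖ < 1) (hq : ‖q‖ < 1) (n : ℕ) :
    qPochhammer a q n ≠ 0 :=
  Finset.prod_ne_zero_iff.mpr fun k _ => one_sub_mul_pow_ne_zero ha hq k

theorem tendsto_inv_qPochhammer {a q : ℂ} (ha : ‖a‖ < 1) (hq : ‖q‖ < 1) :
    Tendsto (fun n => (qPochhammer a q n)⁻¹) atTop (𝓝 (qPochhammerInf a q)⁻¹) :=
  (tendsto_qPochhammer a hq).inv₀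
    (qPochhammerInf_ne_zero hq (one_sub_mul_pow_ne_zero ha hq))

theorem exists_norm_inv_qPochhammer_le {a q : ℂ} (ha : ‖a‖ < 1) (hq : ‖q‖ < 1) :
    ∃ C : ℝ, 0 ≤ C ∧ ∀ n, ‖(qPochhammer a q n)⁻¹‖ ≤ C := by
  obtain ⟨C, hC⟩ := (tendsto_inv_qPochhammer ha hq).norm.bddAbove_range
  exact ⟨C, (norm_nonneg _).trans (hC ⟨0, rfl⟩), fun n => hC ⟨n, rfl⟩⟩

theorem norm_pow_lt_one {q : ℂ} (hq : ‖q‖ < 1) {k : ℕ} (hk : k ≠ 0) : ‖q ^ k‖ < 1 := by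
  rw [norm_pow]; exact pow_lt_one₀ (norm_nonneg q) hq hk

theorem norm_pow_le_of_le {q : ℂ} (hq : ‖q‖ < 1) {m n : ℕ} (h : m ≤ n) :
    ‖q ^ n‖ ≤ ‖q‖ ^ m := by
  rw [norm_pow]; exact pow_le_pow_of_le_one (norm_nonneg q) hq.le h

theorem summable_pow_div_qPochhammer {a p q : ℂ} (ha : ‖a‖ < 1) (hp : ‖p‖ < 1) (hq : ‖q‖ < 1)
    (e : ℕ → ℕ) (he : ∀ n, n ≤ e n) :
    Summable fun n : ℕ => q ^ e n / qPochhammer a p n := by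
  obtain ⟨C, hC0, hC⟩ := exists_norm_inv_qPochhammer_le ha hp
  refine ((summable_geometric_of_lt_one (norm_nonneg q) hq).mul_right C).of_norm_bounded
    fun n => ?_
  rw [div_eq_mul_inv, norm_mul]
  exact mul_le_mul (norm_pow_le_of_le hq (he n)) (hC n) (norm_nonneg _) (by positivity)

/-! ### Euler's expansion of an infinite product. -/

/-- The exponential generating series of Euler, `∑ Q^{m(m-1)/2} x^m / (Q;Q)_m`. -/
noncomputable def eulerSeries (Q x : ℂ) : ℂ :=
  ∑' m : ℕ, Q ^ (m.choose 2) * x ^ m / qPochhammer Q Q m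

theorem exists_euler_term_bound {Q : ℂ} (hQ : ‖Q‖ < 1) :
    ∃ C : ℝ, 0 ≤ C ∧ ∀ (x : ℂ) (m : ℕ),
      ‖Q ^ (m.choose 2) * x ^ m / qPochhammer Q Q m‖ ≤ C * ‖x‖ ^ m := by
  obtain ⟨C, hC0, hC⟩ := exists_norm_inv_qPochhammer_le hQ hQ
  refine ⟨C, hC0, fun x m => ?_⟩
  rw [div_eq_mul_inv, norm_mul, norm_mul, norm_pow x, mul_comm C]
  refine mul_le_mul ?_ (hC m) (norm_nonneg _) (by positivity)
  exact mul_le_of_le_one_left (by positivity) (by simpa using norm_pow_le_of_le hQ (Nat.zero_le _))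

theorem summable_euler {Q x : ℂ} (hQ : ‖Q‖ < 1) (hx : ‖x‖ < 1) :
    Summable fun m : ℕ => Q ^ (m.choose 2) * x ^ m / qPochhammer Q Q m := by
  obtain ⟨C, -, hC⟩ := exists_euler_term_bound hQ
  exact ((summable_geometric_of_lt_one (norm_nonneg x) hx).mul_left C).of_norm_bounded (hC x)

/-- In the term of index `m + 1`, write `1 = Q^(m+1) + (1 - Q^(m+1))`: the second summand cancels
the last factor of the denominator and leaves `x` times term `m` at `x * Q`. -/
theorem eulerSeries_eq {Q x : ℂ} (hQ : ‖Q‖ < 1) (hx : ‖x‖ < 1) :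
    eulerSeries Q x = (1 + x) * eulerSeries Q (x * Q) := by
  have hxQ : ‖x * Q‖ < 1 := by
    rw [norm_mul]; nlinarith [norm_nonneg x, norm_nonneg Q]
  have h1 := summable_euler hQ hx
  have h2 := summable_euler hQ hxQ
  have h2' := (summable_nat_add_iff 1).mpr h2
  have key : ∀ m : ℕ, Q ^ ((m + 1).choose 2) * x ^ (m + 1) / qPochhammer Q Q (m + 1) =
      Q ^ ((m + 1).choose 2) * (x * Q) ^ (m + 1) / qPochhammer Q Q (m + 1) +
        x * (Q ^ (m.choose 2) * (x * Q) ^ m / qPochhammer Q Q m) := by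
    intro m
    have e1 := qPochhammer_ne_zero hQ hQ m
    have e2 := one_sub_mul_pow_ne_zero hQ hQ m
    rw [← pow_succ'] at e2
    rw [qPochhammer_succ, Nat.choose_succ_succ' m 1, Nat.choose_one_right, pow_add]
    rw [← pow_succ']
    field_simp
    ring
  unfold eulerSeries
  rw [add_mul, one_mul, h1.tsum_eq_zero_add]
  simp_rw [key]
  rw [h2'.tsum_add (h2.mul_left x), tsum_mul_left]
  conv_rhs => rw [h2.tsum_eq_zero_add]
  simp [add_assoc]
  left; rw [h2.tsum_eq_zero_add]; simp

/-- Iterating the functional equation peels off the product's factors; the remaining series at `x *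
Q ^ n` tends to 1 by dominated convergence. -/
theorem qPochhammerInf_neg_eq_eulerSeries {Q x : ℂ} (hQ : ‖Q‖ < 1) (hx : ‖x‖ < 1) :
    qPochhammerInf (-x) Q = eulerSeries Q x := by
  have hxn : ∀ n : ℕ, ‖x * Q ^ n‖ < 1 := fun n => by
    rw [norm_mul]
    have := norm_pow_le_of_le hQ (Nat.zero_le n)
    nlinarith [norm_nonneg x, norm_nonneg (Q ^ n)]
  have h1 : ∀ n, eulerSeries Q x = qPochhammer (-x) Q n * eulerSeries Q (x * Q ^ n) := by
    intro n
    induction n with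
    | zero => simp [qPochhammer_zero]
    | succ n ih =>
      rw [ih, eulerSeries_eq hQ (hxn n), qPochhammer_succ]
      ring_nf
  have h2 : Tendsto (fun n : ℕ => eulerSeries Q (x * Q ^ n)) atTop (𝓝 1) := by
    obtain ⟨C, hC0, hC⟩ := exists_euler_term_bound hQ
    have h3 : Tendsto (fun n : ℕ => x * Q ^ n) atTop (𝓝 0) := by
      simpa using (tendsto_pow_atTop_nhds_zero_of_norm_lt_one hQ).const_mul x
    have := tendsto_tsum_of_dominated_convergence (𝓕 := atTop)
      (f := fun n m : ℕ => Q ^ (m.choose 2) * (x * Q ^ n) ^ m / qPochhammer Q Q m)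
      (g := fun m : ℕ => Q ^ (m.choose 2) * 0 ^ m / qPochhammer Q Q m)
      ((summable_geometric_of_lt_one (norm_nonneg x) hx).mul_left C)
      (fun m => ((h3.pow m).const_mul _).div_const _)
      (Eventually.of_forall fun n m => (hC _ m).trans <| by
        gcongr
        rw [norm_mul]
        exact mul_le_of_le_one_right (norm_nonneg x)
          (by simpa using norm_pow_le_of_le hQ (Nat.zero_le n)))
    rw [tsum_eq_single 0 (by intro m hm; simp [hm])] at this
    simpa [eulerSeries, qPochhammer_zero] using this
  have h4 := (tendsto_qPochhammer (-x) hQ).mul h2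
  simp only [← h1, mul_one] at h4
  exact tendsto_nhds_unique h4 tendsto_const_nhds

/-! ### The convolution formula for `1/(q;q)_N`. -/

section PowerSeries
open PowerSeries

/-- The power series `∑ X^n / (Q;Q)_n`. -/
noncomputable def qExp (Q : ℂ) : PowerSeries ℂ := PowerSeries.mk fun n => (qPochhammer Q Q n)⁻¹

theorem rescale_qExp {Q : ℂ} (hQ : ‖Q‖ < 1) :
    rescale Q (qExp Q) = (1 - X) * qExp Q := by
  ext n
  rw [sub_mul, one_mul, map_sub, coeff_rescale]
  cases n with
  | zero => simp [qExp]
  | succ n =>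
    rw [coeff_succ_X_mul]
    have e1 := qPochhammer_ne_zero hQ hQ n
    have e2 := one_sub_mul_pow_ne_zero hQ hQ n
    simp only [qExp, coeff_mk, qPochhammer_succ]
    field_simp
    ring

/-- The functional equation of `1/(X;Q)_∞` amounts to the recursion `(1 - Q^(n+1)) a_(n+1) = a_n`.
-/
theorem eq_qExp {Q : ℂ} (hQ : ‖Q‖ < 1) {P : PowerSeries ℂ} (h0 : coeff 0 P = 1)
    (h : rescale Q P = (1 - X) * P) : P = qExp Q := by
  ext n
  induction n with
  | zero => simpa [qExp, qPochhammer_zero] using h0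
  | succ n ih =>
    have h1 := congrArg (coeff (n + 1)) h
    rw [sub_mul, one_mul, map_sub, coeff_rescale, coeff_succ_X_mul, ih] at h1
    have e1 := qPochhammer_ne_zero hQ hQ n
    have e2 := one_sub_mul_pow_ne_zero hQ hQ n
    simp only [qExp, coeff_mk, qPochhammer_succ] at h1 ⊢
    field_simp at h1 ⊢
    linear_combination -h1

/-- Formally, this sorts the factors `1 - X q^k` of `(X;q)_∞` by the parity of `k`. -/
theorem qExp_sq_mul_rescale {q : ℂ} (hq : ‖q‖ < 1) :
    qExp (q ^ 2) * rescale q (qExp (q ^ 2)) = qExp q := by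
  have hq2 := norm_pow_lt_one hq two_ne_zero
  refine eq_qExp hq (by simp [coeff_mul, coeff_rescale, qExp, qPochhammer_zero,
    -coeff_zero_eq_constantCoeff]) ?_
  rw [map_mul, rescale_rescale, ← sq, rescale_qExp hq2]
  ring

theorem sum_antidiagonal_pow_div {q : ℂ} (hq : ‖q‖ < 1) (N : ℕ) :
    ∑ p ∈ Finset.HasAntidiagonal.antidiagonal N,
      q ^ p.2 / (qPochhammer (q ^ 2) (q ^ 2) p.1 * qPochhammer (q ^ 2) (q ^ 2) p.2) =
      (qPochhammer q q N)⁻¹ := by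
  have h := congrArg (coeff N) (qExp_sq_mul_rescale hq)
  rw [coeff_mul] at h
  simp only [coeff_rescale, qExp, coeff_mk] at h
  rw [← h]
  refine Finset.sum_congr rfl fun p _ => ?_
  rw [div_eq_mul_inv, mul_inv]
  ring

end PowerSeries

/-! ### Rogers' identity. -/

theorem qPochhammer_sq_sq (q : ℂ) (n : ℕ) :
    qPochhammer (q ^ 2) (q ^ 2) n = qPochhammer q q n * qPochhammer (-q) q n := by
  simp only [qPochhammer, ← Finset.prod_mul_distrib]
  refine Finset.prod_congr rfl fun k _ => ?_
  ring

theorem tsum_rogers {q : ℂ} (hq : ‖q‖ < 1) :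
    ∑' n : ℕ, q ^ (n ^ 2) / qPochhammer q q n =
      (∑' n : ℕ, q ^ (n ^ 2) / qPochhammer (q ^ 4) (q ^ 4) n) * qPochhammerInf (-q ^ 2) (q ^ 2) := by
  have hq2 := norm_pow_lt_one hq two_ne_zero
  set Q := q ^ 2 with hQ
  let F : ℕ × ℕ → ℂ := fun p => q ^ ((p.1 + p.2) ^ 2) *
    (q ^ p.2 / (qPochhammer Q Q p.1 * qPochhammer Q Q p.2))
  have hF : Summable F := by
    obtain ⟨C, hC0, hC⟩ := exists_norm_inv_qPochhammer_le hq2 hq2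
    have hg := summable_geometric_of_lt_one (norm_nonneg q) hq
    refine ((hg.mul_of_nonneg hg (fun _ => by positivity) fun _ => by positivity).mul_right
      (C * C)).of_norm_bounded fun p => ?_
    have e : F p = q ^ ((p.1 + p.2) ^ 2 + p.2) *
        ((qPochhammer Q Q p.1)⁻¹ * (qPochhammer Q Q p.2)⁻¹) := by
      simp only [F]; rw [pow_add, div_eq_mul_inv, mul_inv]; ring
    rw [e, norm_mul, norm_mul, ← pow_add]
    refine mul_le_mul (norm_pow_le_of_le hq ?_) (mul_le_mul (hC _) (hC _) (norm_nonneg _) hC0)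
      (by positivity) (by positivity)
    nlinarith [Nat.le_self_pow two_ne_zero (p.1 + p.2)]
  have h1 : ∑' p, F p = ∑' n : ℕ, q ^ (n ^ 2) / qPochhammer q q n := by
    rw [← Finset.HasAntidiagonal.sigmaAntidiagonalEquivProd.tsum_eq,
      Summable.tsum_sigma
        (f := fun c => F (Finset.HasAntidiagonal.sigmaAntidiagonalEquivProd c))
        (Finset.HasAntidiagonal.sigmaAntidiagonalEquivProd.summable_iff.mpr hF)]
    refine tsum_congr fun n => ?_
    simp only [Finset.HasAntidiagonal.sigmaAntidiagonalEquivProd_apply]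
    rw [tsum_fintype, Finset.sum_coe_sort (Finset.HasAntidiagonal.antidiagonal n) F, div_eq_mul_inv,
      ← sum_antidiagonal_pow_div hq, Finset.mul_sum]
    refine Finset.sum_congr rfl fun p hp => ?_
    simp only [F, Finset.HasAntidiagonal.mem_antidiagonal.mp hp, ← hQ]
  rw [← h1, hF.tsum_prod, ← tsum_mul_right]
  refine tsum_congr fun n => ?_
  have hx : ‖Q * Q ^ n‖ < 1 := by
    rw [← pow_succ']; exact norm_pow_lt_one hq2 n.succ_ne_zero
  have e4 : q ^ 4 = Q ^ 2 := by rw [hQ]; ring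
  have hQn := qPochhammer_ne_zero hq2 hq2 n
  have hQn' : qPochhammer (-Q) Q n ≠ 0 := qPochhammer_ne_zero (by simpa using hq2) hq2 n
  have e2 : -q ^ 2 = -Q := by rw [hQ]
  -- The first `n` factors of `(-Q;Q)_∞` turn `(Q^2;Q^2)_n` into `(Q;Q)_n`; Euler's formula expands
  -- the rest.
  rw [qPochhammerInf_eq_mul _ hq2 n, neg_mul, qPochhammerInf_neg_eq_eulerSeries hq2 hx, e4,
    qPochhammer_sq_sq, eulerSeries]
  have : q ^ n ^ 2 / (qPochhammer Q Q n * qPochhammer (-Q) Q n) * (qPochhammer (-Q) Q n *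
      ∑' m : ℕ, Q ^ m.choose 2 * (Q * Q ^ n) ^ m / qPochhammer Q Q m) =
      q ^ n ^ 2 / qPochhammer Q Q n *
      ∑' m : ℕ, Q ^ m.choose 2 * (Q * Q ^ n) ^ m / qPochhammer Q Q m := by
    field_simp
  rw [this, ← tsum_mul_left]
  refine tsum_congr fun m => ?_
  have e : Q ^ m.choose 2 * Q ^ m = q ^ (m ^ 2 + m) := by
    rw [hQ, ← pow_add, ← pow_mul]
    congr 1
    rw [Nat.choose_two_right]
    have h2 : 2 ∣ m * (m - 1) := (Nat.even_mul_pred_self m).two_dvd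
    have h3 : m * (m - 1) + m = m ^ 2 := by cases m <;> simp; ring
    omega
  simp only [F]
  rw [mul_pow, ← mul_assoc, e]
  -- The cross term `2nm` of the square is absorbed by the argument `Q * Q ^ n` of Euler's series.
  have : q ^ (n + m) ^ 2 * q ^ m = q ^ n ^ 2 * (q ^ (m ^ 2 + m) * (Q ^ n) ^ m) := by
    rw [hQ]; ring
  rw [div_mul_div_comm, ← this, mul_div_assoc]

/-! ### The generating function of partitions, by multiplicities of parts. -/

section Multiplicities

variable {𝕜 : Type*} [NormedField 𝕜] [CompleteSpace 𝕜]

theorem hasSum_pow_sum_fin {q : 𝕜} (hq : ‖q‖ < 1) (N : ℕ) :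
    (Summable fun d : Fin N → ℕ => ‖q ^ ∑ i, d i * ((i : ℕ) + 1)‖) ∧
      HasSum (fun d : Fin N → ℕ => q ^ ∑ i, d i * ((i : ℕ) + 1))
        (∏ k ∈ Finset.range N, (1 - q * q ^ k))⁻¹ := by
  induction N with
  | zero =>
    refine ⟨(hasSum_fintype _).summable, ?_⟩
    convert hasSum_fintype fun d : Fin 0 → ℕ => q ^ ∑ i, d i * ((i : ℕ) + 1) using 1
    simp
  | succ N ih =>
    have hq' : ‖q ^ (N + 1)‖ < 1 := by
      rw [norm_pow]; exact pow_lt_one₀ (norm_nonneg q) hq N.succ_ne_zero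
    have hg : Summable fun m : ℕ => ‖(q ^ (N + 1)) ^ m‖ := by
      simpa using summable_geometric_of_lt_one (norm_nonneg (q ^ (N + 1))) hq'
    have e : ∀ p : ℕ × (Fin N → ℕ),
        q ^ ∑ i, (Fin.snocEquiv (fun _ => ℕ) p) i * ((i : ℕ) + 1) =
          (q ^ (N + 1)) ^ p.1 * q ^ ∑ i, p.2 i * ((i : ℕ) + 1) := by
      intro p
      rw [Fin.sum_univ_castSucc, ← pow_mul, ← pow_add, add_comm]
      simp [Fin.snocEquiv, mul_comm]
    have h1 := hg.mul_norm ih.1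
    have h2 := (hasSum_geometric_of_norm_lt_one hq').mul ih.2 h1.of_norm
    simp only [← e] at h1 h2
    rw [pow_succ', ← mul_inv_rev, ← Finset.prod_range_succ] at h2
    exact ⟨(Fin.snocEquiv fun _ => ℕ).summable_iff.mp h1,
      (Fin.snocEquiv fun _ => ℕ).hasSum_iff.mp h2⟩

/-- The size of the partition with `d k` parts equal to `k + 1`. -/
noncomputable def multWeight : (ℕ →₀ ℕ) →+ ℕ := Finsupp.weight fun k : ℕ => k + 1

/-- The multiplicity functions vanishing from `N` on. -/
def supportedBelow (N : ℕ) : Set (ℕ →₀ ℕ) := {d | ∀ k, N ≤ k → d k = 0}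

theorem mem_supportedBelow {N : ℕ} {d : ℕ →₀ ℕ} :
    d ∈ supportedBelow N ↔ ∀ k, N ≤ k → d k = 0 := Iff.rfl

theorem hasSum_indicator_multWeight {q : 𝕜} (hq : ‖q‖ < 1) (N : ℕ) :
    HasSum (Set.indicator (supportedBelow N) fun d => q ^ multWeight d)
      (∏ k ∈ Finset.range N, (1 - q * q ^ k))⁻¹ := by
  let i : (Fin N → ℕ) → ℕ →₀ ℕ := fun d =>
    (Finsupp.equivFunOnFinite.symm d).embDomain Fin.valEmbedding
  have hi : Function.Injective i :=
    (Finsupp.embDomain_injective _).comp Finsupp.equivFunOnFinite.symm.injective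
  have hmem : ∀ d k, N ≤ k → i d k = 0 := fun d k hk =>
    Finsupp.embDomain_of_notMem_range _ _ _ (by
      rintro ⟨x, rfl⟩
      exact absurd x.2 (not_lt.mpr hk))
  refine (hi.hasSum_iff ?_).mp ?_
  · intro d hd
    refine Set.indicator_of_notMem (fun h => hd ⟨fun x => d x, ?_⟩) _
    ext k
    by_cases hk : k < N
    · exact Finsupp.embDomain_apply_self Fin.valEmbedding _ (⟨k, hk⟩ : Fin N)
    · rw [hmem _ _ (not_lt.mp hk), mem_supportedBelow.mp h k (not_lt.mp hk)]
  · refine (hasSum_pow_sum_fin hq N).2.congr_fun ?_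
    intro d
    rw [Function.comp_apply, Set.indicator_of_mem (mem_supportedBelow.mpr (hmem d))]
    simp only [multWeight, Finsupp.weight_apply, i, Finsupp.sum_embDomain]
    rw [Finsupp.sum_fintype _ _ (by simp)]
    simp

end Multiplicities

/-- Any finite subfamily has parts below some `N`, so its sum is at most the inverse of a finite
product at `‖q‖`, bounded uniformly in `N`. -/
theorem summable_norm_pow_multWeight {q : ℂ} (hq : ‖q‖ < 1) :
    Summable fun d : ℕ →₀ ℕ => ‖q ^ multWeight d‖ := by
  have hr : ‖(‖q‖ : ℂ)‖ < 1 := by simpa using hq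
  obtain ⟨C, -, hC⟩ := exists_norm_inv_qPochhammer_le hr hr
  simp only [norm_pow]
  refine summable_of_sum_le (c := C) (fun d => by positivity) fun u => ?_
  obtain ⟨N, hN⟩ : ∃ N, ∀ d ∈ u, ∀ k, N ≤ k → d k = 0 := by
    refine ⟨(u.biUnion Finsupp.support).sup id + 1, fun d hd k hk => ?_⟩
    by_contra h
    have : k ≤ (u.biUnion Finsupp.support).sup id :=
      Finset.le_sup (f := id) (Finset.mem_biUnion.mpr ⟨d, hd, Finsupp.mem_support_iff.mpr h⟩)
    omega
  have hs := hasSum_indicator_multWeight (q := ‖q‖) (by simpa using hq) N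
  calc ∑ d ∈ u, ‖q‖ ^ multWeight d
      = ∑ d ∈ u, Set.indicator (supportedBelow N)
          (fun d => ‖q‖ ^ multWeight d) d :=
        Finset.sum_congr rfl fun d hd => by
          rw [Set.indicator_of_mem (mem_supportedBelow.mpr (hN d hd))]
    _ ≤ (∏ k ∈ Finset.range N, (1 - ‖q‖ * ‖q‖ ^ k))⁻¹ :=
        sum_le_hasSum u (fun d _ => Set.indicator_nonneg (fun _ _ => by positivity) d) hs
    _ ≤ ‖(∏ k ∈ Finset.range N, (1 - ‖q‖ * ‖q‖ ^ k))⁻¹‖ := le_abs_self _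
    _ = ‖(qPochhammer (‖q‖ : ℂ) ‖q‖ N)⁻¹‖ := by
        rw [← Complex.norm_real]; simp [qPochhammer]
    _ ≤ C := hC N

theorem hasSum_pow_multWeight {q : ℂ} (hq : ‖q‖ < 1) :
    HasSum (fun d : ℕ →₀ ℕ => q ^ multWeight d) (qPochhammerInf q q)⁻¹ := by
  have hs := summable_norm_pow_multWeight hq
  have ht := tendsto_tsum_of_dominated_convergence (𝓕 := atTop) hs
    (f := fun N : ℕ =>
      Set.indicator (supportedBelow N) fun d => q ^ multWeight d)
    (g := fun d => q ^ multWeight d)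
    (fun d => by
      refine tendsto_const_nhds.congr' ?_
      filter_upwards [eventually_gt_atTop (d.support.sup id)] with N hN
      rw [Set.indicator_of_mem]
      refine mem_supportedBelow.mpr fun k hk => ?_
      by_contra h
      have : k ≤ d.support.sup id := Finset.le_sup (f := id) (Finsupp.mem_support_iff.mpr h)
      omega)
    (Eventually.of_forall fun N d => norm_indicator_le_norm_self _ _)
  simp only [(hasSum_indicator_multWeight hq _).tsum_eq] at ht
  rw [tendsto_nhds_unique (tendsto_inv_qPochhammer hq hq) ht]
  exact hs.of_norm.hasSum

/-! ### Gapped sets and the Rogers–Ramanujan sum. -/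

/-- Finite sets of natural numbers without two consecutive elements. -/
abbrev GappedFinset : Type := {S : Finset ℕ // ∀ n ∈ S, n + 1 ∉ S}

namespace GappedFinset

/-- The sum of the elements of `S`, each increased by one. -/
def weight (S : GappedFinset) : ℕ := ∑ n ∈ S.1, (n + 1)

/-- Translate a gapped set by one. -/
def shift (S : GappedFinset) : GappedFinset :=
  ⟨S.1.map (addRightEmbedding 1), by
    intro n hn hn'
    simp only [Finset.mem_map, addRightEmbedding_apply] at hn hn'
    obtain ⟨a, ha, rfl⟩ := hn
    obtain ⟨b, hb, hab⟩ := hn'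
    obtain rfl : b = a + 1 := by omega
    exact S.2 a ha hb⟩

/-- Translate a gapped set by two and insert zero. -/
def consShift (S : GappedFinset) : GappedFinset :=
  ⟨insert 0 (S.1.map (addRightEmbedding 2)), by
    intro n hn hn'
    simp only [Finset.mem_insert, Finset.mem_map, addRightEmbedding_apply] at hn hn'
    obtain ⟨b, hb, hab⟩ : ∃ b ∈ S.1, b + 2 = n + 1 := by
      rcases hn' with h | h
      · omega
      · exact h
    rcases hn with h | ⟨a, ha, rfl⟩
    · omega
    · obtain rfl : b = a + 1 := by omega
      exact S.2 a ha hb⟩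

theorem zero_notMem_shift (S : GappedFinset) : 0 ∉ S.shift.1 := by simp [shift]

theorem succ_mem_shift (S : GappedFinset) (n : ℕ) : n + 1 ∈ S.shift.1 ↔ n ∈ S.1 := by
  simp [shift]

theorem zero_mem_consShift (S : GappedFinset) : 0 ∈ S.consShift.1 := by simp [consShift]

theorem add_two_mem_consShift (S : GappedFinset) (n : ℕ) :
    n + 2 ∈ S.consShift.1 ↔ n ∈ S.1 := by
  simp [consShift]

theorem card_shift (S : GappedFinset) : S.shift.1.card = S.1.card := by simp [shift]

theorem card_consShift (S : GappedFinset) : S.consShift.1.card = S.1.card + 1 := by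
  simp [consShift]

theorem weight_shift (S : GappedFinset) : S.shift.weight = S.1.card + S.weight := by
  simp [weight, shift, Finset.sum_add_distrib]; ring

theorem weight_consShift (S : GappedFinset) :
    S.consShift.weight = 2 * S.1.card + 1 + S.weight := by
  simp [weight, consShift, Finset.sum_add_distrib]; ring

/-- The two cases are `0 ∉ T` and `0 ∈ T`; in the latter 1 is excluded, so the other elements can be
lowered by two. -/
theorem bijective_sumElim : Function.Bijective (Sum.elim shift consShift) := by
  constructor
  · refine Function.Injective.sumElim ?_ ?_ ?_
    · intro S T h
      ext n
      rw [← succ_mem_shift, h, succ_mem_shift]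
    · intro S T h
      ext n
      rw [← add_two_mem_consShift, h, add_two_mem_consShift]
    · intro S T h
      exact zero_notMem_shift S (h ▸ zero_mem_consShift T)
  · intro T
    by_cases h0 : 0 ∈ T.1
    · have h1 : 1 ∉ T.1 := T.2 0 h0
      refine ⟨.inr ⟨T.1.preimage (· + 2) (add_left_injective 2).injOn, fun n hn hn' => ?_⟩, ?_⟩
      · simp only [Finset.mem_preimage] at hn hn'
        exact T.2 _ hn (by convert hn' using 1)
      · ext n
        rcases n with _ | _ | n
        · simp [consShift, h0]
        · simp [consShift, h1]
        · simp [consShift]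
    · refine ⟨.inl ⟨T.1.preimage (· + 1) (add_left_injective 1).injOn, fun n hn hn' => ?_⟩, ?_⟩
      · simp only [Finset.mem_preimage] at hn hn'
        exact T.2 _ hn hn'
      · ext n
        rcases n with _ | n
        · simp [shift, h0]
        · simp [shift]

/-- Dropping the gap condition gives the expansion of the convergent product `∏ (1 + ‖q‖^(n+1))`. -/
theorem summable_norm_pow_weight {q : ℂ} (hq : ‖q‖ < 1) :
    Summable fun S : GappedFinset => ‖q ^ S.weight‖ := by
  have h := summable_finsetProd_of_summable_nonneg (f := fun n : ℕ => ‖q‖ ^ (n + 1))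
    (fun n => by positivity)
    ((summable_nat_add_iff 1).mpr (summable_geometric_of_lt_one (norm_nonneg q) hq))
  simpa [Function.comp_def, weight, Finset.prod_pow_eq_pow_sum] using
    h.comp_injective (Subtype.val_injective (p := fun S : Finset ℕ => ∀ n ∈ S, n + 1 ∉ S))

/-- The term of `S` in the generating function of the gapped sets with `n` elements. -/
noncomputable def cardTerm (q : ℂ) (n : ℕ) (S : GappedFinset) : ℂ :=
  Set.indicator {S : GappedFinset | S.1.card = n} (fun S => q ^ S.weight) S

theorem cardTerm_shift (q : ℂ) (n : ℕ) (S : GappedFinset) :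
    cardTerm q n S.shift = q ^ n * cardTerm q n S := by
  simp only [cardTerm, Set.indicator_apply, Set.mem_ofPred_eq, card_shift, weight_shift]
  split_ifs with h
  · rw [pow_add, h]
  · simp

theorem cardTerm_consShift (q : ℂ) (n : ℕ) (S : GappedFinset) :
    cardTerm q (n + 1) S.consShift = q ^ (2 * n + 1) * cardTerm q n S := by
  simp only [cardTerm, Set.indicator_apply, Set.mem_ofPred_eq, card_consShift, weight_consShift,
    add_left_inj]
  split_ifs with h
  · rw [pow_add, h]
  · simp

theorem summable_cardTerm {q : ℂ} (hq : ‖q‖ < 1) (n : ℕ) : Summable (cardTerm q n) :=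
  (summable_norm_pow_weight hq).of_norm_bounded fun _ => norm_indicator_le_norm_self _ _

theorem tsum_cardTerm_succ {q : ℂ} (hq : ‖q‖ < 1) (n : ℕ) :
    ∑' S, cardTerm q (n + 1) S =
      q ^ (n + 1) * ∑' S, cardTerm q (n + 1) S + q ^ (2 * n + 1) * ∑' S, cardTerm q n S := by
  have h1 := (summable_cardTerm hq (n + 1)).hasSum.mul_left (q ^ (n + 1))
  have h2 := (summable_cardTerm hq n).hasSum.mul_left (q ^ (2 * n + 1))
  simp only [← cardTerm_shift] at h1
  simp only [← cardTerm_consShift] at h2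
  have h3 : HasSum (cardTerm q (n + 1) ∘ Equiv.ofBijective _ bijective_sumElim) _ :=
    HasSum.sum h1 h2
  exact ((Equiv.hasSum_iff _).mp h3).tsum_eq

theorem tsum_cardTerm {q : ℂ} (hq : ‖q‖ < 1) (n : ℕ) :
    ∑' S, cardTerm q n S = q ^ (n ^ 2) / qPochhammer q q n := by
  induction n with
  | zero =>
    rw [tsum_eq_single ⟨∅, by simp⟩]
    · simp [cardTerm, weight, qPochhammer_zero]
    · intro S hS
      rw [cardTerm, Set.indicator_of_notMem]
      exact fun h => hS (Subtype.ext (Finset.card_eq_zero.mp h))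
  | succ n ih =>
    have h := tsum_cardTerm_succ hq n
    rw [ih] at h
    have d1 := qPochhammer_ne_zero hq hq n
    have d2 := one_sub_mul_pow_ne_zero hq hq n
    rw [qPochhammer_succ, eq_div_iff (mul_ne_zero d1 d2)]
    have h' : (∑' S, cardTerm q (n + 1) S) * (1 - q * q ^ n) =
        q ^ (2 * n + 1) * (q ^ (n ^ 2) / qPochhammer q q n) := by
      linear_combination h
    calc (∑' S, cardTerm q (n + 1) S) * (qPochhammer q q n * (1 - q * q ^ n))
        = (∑' S, cardTerm q (n + 1) S) * (1 - q * q ^ n) * qPochhammer q q n := by ring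
      _ = q ^ (2 * n + 1) * q ^ (n ^ 2) := by rw [h', mul_assoc, div_mul_cancel₀ _ d1]
      _ = q ^ ((n + 1) ^ 2) := by ring

theorem hasSum_pow_weight {q : ℂ} (hq : ‖q‖ < 1) :
    HasSum (fun S : GappedFinset => q ^ S.weight)
      (∑' n : ℕ, q ^ (n ^ 2) / qPochhammer q q n) := by
  have hs := (summable_norm_pow_weight hq).of_norm
  let e := Equiv.sigmaFiberEquiv fun S : GappedFinset => S.1.card
  have h1 : Summable ((fun S : GappedFinset => q ^ S.weight) ∘ e) := e.summable_iff.mpr hs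
  have h2 := e.tsum_eq fun S : GappedFinset => q ^ S.weight
  rw [hs.hasSum_iff, ← h2]
  refine h1.tsum_sigma.trans (tsum_congr fun n => ?_)
  rw [← tsum_cardTerm hq]
  exact tsum_subtype {S : GappedFinset | S.1.card = n} fun S => q ^ S.weight

end GappedFinset

/-! ### Sorting nearly antitone sequences into partitions. -/

/-- The sequence of tail sums `n ↦ ∑_{k ≥ n} d k`, i.e. the partition whose conjugate has
`d k` parts equal to `k + 1`. -/
noncomputable def tailSum : (ℕ →₀ ℕ) →+ (ℕ →₀ ℕ) :=
  Finsupp.liftAddHom fun k => ∑ j ∈ Finset.range (k + 1), Finsupp.singleAddHom j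

theorem tailSum_single (k m : ℕ) :
    tailSum (Finsupp.single k m) = ∑ j ∈ Finset.range (k + 1), Finsupp.single j m := by
  simp [tailSum]

theorem tailSum_single_apply (k m n : ℕ) :
    tailSum (Finsupp.single k m) n = if n ≤ k then m else 0 := by
  simp [tailSum_single, Finsupp.finsetSum_apply, Finsupp.single_apply]

theorem tailSum_apply (d : ℕ →₀ ℕ) (n : ℕ) : tailSum d n = d n + tailSum d (n + 1) := by
  induction d using Finsupp.induction_linear with
  | zero => simp
  | add f g hf hg => simp only [map_add, Finsupp.add_apply, hf, hg]; ring
  | single k m =>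
    rw [tailSum_single_apply, tailSum_single_apply, Finsupp.single_apply]
    split_ifs <;> omega

theorem degree_tailSum (d : ℕ →₀ ℕ) : (tailSum d).degree = multWeight d := by
  induction d using Finsupp.induction_linear with
  | zero => simp
  | add f g hf hg => simp only [map_add, hf, hg]
  | single k m => simp [tailSum_single, multWeight, Finsupp.weight_single, mul_comm]

theorem tailSum_antitone (d : ℕ →₀ ℕ) : Antitone (tailSum d) :=
  antitone_nat_of_succ_le fun n => by rw [tailSum_apply d n]; omega

theorem eq_tailSum {g d : ℕ →₀ ℕ} (h : ∀ n, g n = d n + g (n + 1)) : g = tailSum d := by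
  have hz : ∀ f : ℕ →₀ ℕ, ∃ N, ∀ n, N ≤ n → f n = 0 := fun f => by
    refine ⟨f.support.sup id + 1, fun n hn => ?_⟩
    by_contra hc
    have : n ≤ f.support.sup id := Finset.le_sup (f := id) (Finsupp.mem_support_iff.mpr hc)
    omega
  obtain ⟨N, hN⟩ := hz g
  obtain ⟨M, hM⟩ := hz (tailSum d)
  have : ∀ m n, max N M ≤ n + m → g n = tailSum d n := by
    intro m
    induction m with
    | zero => intro n hn; rw [hN n (by omega), hM n (by omega)]
    | succ m ih => intro n hn; rw [h, tailSum_apply, ih (n + 1) (by omega)]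
  ext n
  exact this (max N M) n (by omega)

/-- Finitely supported sequences whose value is at least all values two or more places later. -/
abbrev NearlyAntitone : Type := {f : ℕ →₀ ℕ // ∀ n, f (n + 2) ≤ f n ∧ f (n + 3) ≤ f n}

namespace GappedFinset

/-- The involution exchanging `n` and `n + 1` for each `n ∈ S`. -/
def swapFun (S : GappedFinset) (n : ℕ) : ℕ :=
  if n ∈ S.1 then n + 1 else if n ≠ 0 ∧ n - 1 ∈ S.1 then n - 1 else n

theorem swapFun_of_mem {S : GappedFinset} {n : ℕ} (h : n ∈ S.1) : S.swapFun n = n + 1 :=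
  if_pos h

theorem swapFun_succ_of_mem {S : GappedFinset} {n : ℕ} (h : n ∈ S.1) : S.swapFun (n + 1) = n := by
  simp [swapFun, S.2 n h, h]

theorem swapFun_of_notMem {S : GappedFinset} {n : ℕ} (h : n ∉ S.1) :
    S.swapFun n = n ∨ (S.swapFun n = n - 1 ∧ n ≠ 0 ∧ n - 1 ∈ S.1) := by
  unfold swapFun
  rw [if_neg h]
  split_ifs with h' <;> simp [h']

theorem swapFun_succ_of_notMem {S : GappedFinset} {n : ℕ} (h : n ∉ S.1) :
    S.swapFun (n + 1) = n + 1 ∨ S.swapFun (n + 1) = n + 2 := by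
  unfold swapFun
  split_ifs with h1 h2
  · exact .inr rfl
  · exact absurd h2.2 h
  · exact .inl rfl

theorem swapFun_le (S : GappedFinset) (n : ℕ) : S.swapFun n ≤ n + 1 := by
  unfold swapFun; split_ifs <;> omega

theorem le_swapFun (S : GappedFinset) (n : ℕ) : n ≤ S.swapFun n + 1 := by
  unfold swapFun; split_ifs <;> omega

theorem swapFun_involutive (S : GappedFinset) : Function.Involutive S.swapFun := by
  intro n
  by_cases h : n ∈ S.1
  · rw [swapFun_of_mem h, swapFun_succ_of_mem h]
  · rcases swapFun_of_notMem h with h1 | ⟨h1, h2, h3⟩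
    · rw [h1, h1]
    · rw [h1, swapFun_of_mem h3]; omega

/-- The involution exchanging `n` and `n + 1` for each `n ∈ S`, as a permutation. -/
def swapPerm (S : GappedFinset) : Equiv.Perm ℕ := S.swapFun_involutive.toPerm

/-- The indicator function of `S`. -/
noncomputable def toFinsupp (S : GappedFinset) : ℕ →₀ ℕ := ∑ n ∈ S.1, Finsupp.single n 1

theorem toFinsupp_apply (S : GappedFinset) (n : ℕ) :
    S.toFinsupp n = if n ∈ S.1 then 1 else 0 := by
  simp [toFinsupp, Finsupp.finsetSum_apply, Finsupp.single_apply]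

theorem multWeight_toFinsupp (S : GappedFinset) : multWeight S.toFinsupp = S.weight := by
  simp [toFinsupp, weight, multWeight, Finsupp.weight_single]

/-- The partition with strict descents on `S` and remaining descents `d`, permuted so that it
ascends exactly on `S`. -/
noncomputable def ascendOn (S : GappedFinset) (d : ℕ →₀ ℕ) : ℕ →₀ ℕ :=
  Finsupp.equivMapDomain S.swapPerm (tailSum (d + S.toFinsupp))

theorem ascendOn_apply (S : GappedFinset) (d : ℕ →₀ ℕ) (n : ℕ) :
    S.ascendOn d n = tailSum (d + S.toFinsupp) (S.swapFun n) := rfl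

theorem degree_ascendOn (S : GappedFinset) (d : ℕ →₀ ℕ) :
    (S.ascendOn d).degree = S.weight + multWeight d := by
  rw [ascendOn, Finsupp.equivMapDomain_eq_mapDomain, Finsupp.degree_mapDomain, degree_tailSum,
    map_add, multWeight_toFinsupp, add_comm]

/-- The unit added at `n ∈ S` makes the descent strict before the swap. Hence `S` is recovered as
the ascent set, which gives injectivity. -/
theorem ascendOn_lt_iff (S : GappedFinset) (d : ℕ →₀ ℕ) (n : ℕ) :
    S.ascendOn d n < S.ascendOn d (n + 1) ↔ n ∈ S.1 := by
  rw [ascendOn_apply, ascendOn_apply]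
  by_cases h : n ∈ S.1
  · rw [swapFun_of_mem h, swapFun_succ_of_mem h, tailSum_apply _ n, Finsupp.add_apply,
      toFinsupp_apply, if_pos h]
    simp only [h, iff_true]
    omega
  · simp only [h, iff_false, not_lt]
    refine tailSum_antitone _ ?_
    have h1 := swapFun_of_notMem h
    have h2 := swapFun_succ_of_notMem h
    omega

/-- The swaps move each index by at most one, so they cannot reverse indices two or more apart. -/
theorem ascendOn_le (S : GappedFinset) (d : ℕ →₀ ℕ) {m n : ℕ} (h : m + 2 ≤ n) :
    S.ascendOn d n ≤ S.ascendOn d m := by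
  refine tailSum_antitone _ ?_
  have h1 := S.swapFun_le m
  have h2 := S.le_swapFun n
  show S.swapFun m ≤ S.swapFun n
  omega

/-- A gapped set and a multiplicity function determine a nearly antitone sequence. -/
noncomputable def toNearlyAntitone (p : GappedFinset × (ℕ →₀ ℕ)) : NearlyAntitone :=
  ⟨p.1.ascendOn p.2, fun n => ⟨ascendOn_le _ _ le_rfl, ascendOn_le _ _ (by omega)⟩⟩

theorem toNearlyAntitone_injective : Function.Injective toNearlyAntitone := by
  rintro ⟨S, d⟩ ⟨T, e⟩ h
  have h : S.ascendOn d = T.ascendOn e := congrArg Subtype.val h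
  obtain rfl : S = T := by
    ext n
    rw [← ascendOn_lt_iff S d, h, ascendOn_lt_iff]
  have h1 : tailSum (d + S.toFinsupp) = tailSum (e + S.toFinsupp) :=
    (Finsupp.equivCongrLeft S.swapPerm).injective h
  have h2 : d = e := by
    ext n
    have h3 := tailSum_apply (d + S.toFinsupp) n
    have h4 := tailSum_apply (e + S.toFinsupp) n
    rw [h1] at h3
    simp only [Finsupp.add_apply] at h3 h4
    omega
  rw [h2]

theorem toNearlyAntitone_surjective : Function.Surjective toNearlyAntitone := by
  rintro ⟨f, hf⟩
  obtain ⟨S, hS⟩ : ∃ S : GappedFinset, ∀ n, n ∈ S.1 ↔ f n < f (n + 1) := by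
    -- An ascent at `n` forces `f (n + 1) ≠ 0`, so there are finitely many.
    have hmem : ∀ n, n ∈ (f.support.preimage (· + 1) (add_left_injective 1).injOn).filter
        (fun n => f n < f (n + 1)) ↔ f n < f (n + 1) := by
      intro n
      simp only [Finset.mem_filter, Finset.mem_preimage, Finsupp.mem_support_iff]
      omega
    refine ⟨⟨_, fun n hn hn' => ?_⟩, hmem⟩
    have h1 := (hmem n).mp hn
    have h2 : f (n + 1) < f (n + 2) := (hmem (n + 1)).mp hn'
    have := (hf n).1
    omega
  -- After the swaps every descent is at least the indicator of `S`, so the subtraction defining `d`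
  -- does not truncate.
  have hg : ∀ n, f (S.swapFun (n + 1)) + S.toFinsupp n ≤ f (S.swapFun n) := by
    intro n
    rw [toFinsupp_apply]
    by_cases h : n ∈ S.1
    · rw [swapFun_of_mem h, swapFun_succ_of_mem h, if_pos h]
      exact (hS n).mp h
    · rw [if_neg h, add_zero]
      have h0 : f (n + 1) ≤ f n := not_lt.mp (mt (hS n).mpr h)
      rcases swapFun_of_notMem h with h1 | ⟨h1, h2, -⟩ <;>
        rcases swapFun_succ_of_notMem h with h3 | h3 <;> rw [h1, h3]
      · exact h0
      · exact (hf n).1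
      · obtain ⟨m, rfl⟩ := Nat.exists_eq_succ_of_ne_zero h2
        exact (hf m).1
      · obtain ⟨m, rfl⟩ := Nat.exists_eq_succ_of_ne_zero h2
        exact (hf m).2
  let g : ℕ →₀ ℕ := Finsupp.equivMapDomain S.swapPerm f
  have hgn : ∀ n, g n = f (S.swapFun n) := fun n => rfl
  let d : ℕ →₀ ℕ := Finsupp.onFinset g.support (fun n => g n - g (n + 1) - S.toFinsupp n)
    fun n hn => Finsupp.mem_support_iff.mpr (by omega)
  have hgd : g = tailSum (d + S.toFinsupp) := eq_tailSum fun n => by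
    have h1 := hg n
    rw [← hgn, ← hgn] at h1
    have h2 : d n = g n - g (n + 1) - S.toFinsupp n := rfl
    rw [Finsupp.add_apply]
    omega
  refine ⟨(S, d), Subtype.ext ?_⟩
  ext n
  show tailSum (d + S.toFinsupp) (S.swapFun n) = f n
  rw [← hgd, hgn, S.swapFun_involutive n]

end GappedFinset

theorem hasSum_pow_degree_nearlyAntitone {q : ℂ} (hq : ‖q‖ < 1) :
    HasSum (fun f : NearlyAntitone => q ^ f.1.degree)
      ((∑' n : ℕ, q ^ (n ^ 2) / qPochhammer q q n) * (qPochhammerInf q q)⁻¹) := by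
  rw [← (Equiv.ofBijective _ ⟨GappedFinset.toNearlyAntitone_injective,
    GappedFinset.toNearlyAntitone_surjective⟩).hasSum_iff]
  have hs := (GappedFinset.summable_norm_pow_weight hq).mul_norm (summable_norm_pow_multWeight hq)
  refine ((GappedFinset.hasSum_pow_weight hq).mul (hasSum_pow_multWeight hq)
    hs.of_norm).congr_fun ?_
  intro p
  rw [← pow_add, ← GappedFinset.degree_ascendOn]
  rfl

/-! ### Cylindric partitions as interleaved sequences. -/

/-- Interleave `r` finitely supported sequences along a bijection `Fin r × ℕ ≃ ℕ`. -/
noncomputable def interleave {r : ℕ} (e : Fin r × ℕ ≃ ℕ) : (Fin r → ℕ →₀ ℕ) ≃ (ℕ →₀ ℕ) :=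
  Finsupp.equivFunOnFinite.symm.trans (Finsupp.curryEquiv.symm.trans (Finsupp.equivCongrLeft e))

theorem interleave_apply {r : ℕ} (e : Fin r × ℕ ≃ ℕ) (R : Fin r → ℕ →₀ ℕ) (i : Fin r) (j : ℕ) :
    interleave e R (e (i, j)) = R i j := by
  simp [interleave]

theorem interleave_symm_apply {r : ℕ} (e : Fin r × ℕ ≃ ℕ) (f : ℕ →₀ ℕ) (i : Fin r) (j : ℕ) :
    (interleave e).symm f i j = f (e (i, j)) := by
  rw [← interleave_apply e, Equiv.apply_symm_apply]

theorem degree_interleave {r : ℕ} (e : Fin r × ℕ ≃ ℕ) (R : Fin r → ℕ →₀ ℕ) :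
    (interleave e R).degree = ∑ i, (R i).sum fun _ m => m := by
  simp only [interleave, Equiv.trans_apply, Finsupp.equivCongrLeft_apply,
    Finsupp.equivMapDomain_eq_mapDomain, Finsupp.degree_mapDomain, Finsupp.curryEquiv_symm_apply]
  have := Finsupp.sum_uncurry_index (Finsupp.equivFunOnFinite.symm R) fun _ (m : ℕ) => m
  rw [Finsupp.sum_fintype (Finsupp.equivFunOnFinite.symm R) _ (by simp)] at this
  exact this

theorem hasSum_pow_size {r : ℕ} [NeZero r] {c : Fin r → ℕ} (e : Fin r × ℕ ≃ ℕ)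
    (h : ∀ f : ℕ →₀ ℕ, (∀ n, f (n + 2) ≤ f n ∧ f (n + 3) ≤ f n) ↔
      (∀ i j, f (e (i, j + 1)) ≤ f (e (i, j))) ∧
        ∀ i j, f (e (i + 1, j + c (i + 1))) ≤ f (e (i, j))) {q a : ℂ}
    (ha : HasSum (fun f : NearlyAntitone => q ^ f.1.degree) a) :
    HasSum (fun L : CylindricPartition c => q ^ L.size) a := by
  let E : CylindricPartition c ≃ NearlyAntitone :=
    { toFun := fun L => ⟨interleave e L.row, (h _).mpr (by
        simp only [interleave_apply]
        exact ⟨fun i j => L.antitone_row i j.le_succ, L.interlace⟩)⟩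
      invFun := fun f =>
        { row := (interleave e).symm f.1
          antitone_row := fun i => antitone_nat_of_succ_le fun j => by
            simpa only [interleave_symm_apply] using ((h _).mp f.2).1 i j
          interlace := fun i j => by
            simpa only [interleave_symm_apply] using ((h _).mp f.2).2 i j }
      left_inv := fun L => by ext1; simp
      right_inv := fun f => by simp }
  refine (E.hasSum_iff.mpr ha).congr_fun ?_
  intro L
  simp only [Function.comp_apply, E, Equiv.coe_fn_mk, degree_interleave]
  rfl

/-- The bijection `(i, j) ↦ r * j + i`. -/
def residueEquiv (r : ℕ) [NeZero r] : Fin r × ℕ ≃ ℕ :=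
  (Equiv.prodComm _ _).trans (Nat.divModEquiv r).symm

theorem residueEquiv_apply (r : ℕ) [NeZero r] (i : Fin r) (j : ℕ) :
    residueEquiv r (i, j) = j * r + i := rfl

theorem hasSum_pow_size_two_one {q a : ℂ}
    (ha : HasSum (fun f : NearlyAntitone => q ^ f.1.degree) a) :
    HasSum (fun L : CylindricPartition ![2, 1] => q ^ L.size) a := by
  refine hasSum_pow_size (residueEquiv 2) (fun f => ?_) ha
  simp only [residueEquiv_apply, Fin.forall_fin_two]
  constructor
  · intro h
    refine ⟨⟨fun j => ?_, fun j => ?_⟩, fun j => ?_, fun j => ?_⟩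
    · convert (h (2 * j)).1 using 2 <;> simp <;> ring
    · convert (h (2 * j + 1)).1 using 2 <;> simp <;> ring
    · convert (h (2 * j)).2 using 2 <;> simp <;> ring
    · convert (h (2 * j + 1)).2 using 2 <;> simp <;> ring
  · rintro ⟨⟨h1, h2⟩, h3, h4⟩ n
    obtain ⟨j, rfl | rfl⟩ := n.even_or_odd'
    · constructor
      · convert h1 j using 2 <;> simp <;> ring
      · convert h3 j using 2 <;> simp <;> ring
    · constructor
      · convert h2 j using 2 <;> simp <;> ring
      · convert h4 j using 2 <;> simp <;> ring

theorem hasSum_pow_size_one_one_zero {q a : ℂ}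
    (ha : HasSum (fun f : NearlyAntitone => q ^ f.1.degree) a) :
    HasSum (fun L : CylindricPartition ![1, 1, 0] => q ^ L.size) a := by
  -- Rows 0, 1, 2 occupy residues 1, 0, 2 modulo 3; with this order all three interlacing conditions
  -- compare places exactly two apart.
  refine hasSum_pow_size (((Equiv.swap 0 1).prodCongr (Equiv.refl ℕ)).trans (residueEquiv 3))
    (fun f => ?_) ha
  have s0 : Equiv.swap (0 : Fin 3) 1 0 = 1 := rfl
  have s1 : Equiv.swap (0 : Fin 3) 1 1 = 0 := rfl
  have s2 : Equiv.swap (0 : Fin 3) 1 2 = 2 := rfl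
  have t1 : (1 : Fin 3) + 1 = 2 := rfl
  have t2 : (2 : Fin 3) + 1 = 0 := rfl
  simp only [Equiv.trans_apply, Equiv.prodCongr_apply, Prod.map_apply, Equiv.refl_apply,
    residueEquiv_apply, Fin.forall_fin_succ, IsEmpty.forall_iff, and_true]
  simp only [Fin.isValue, s0, Fin.coe_ofNat_eq_mod, Nat.one_mod, Fin.succ_zero_eq_one, s1,
    Nat.zero_mod, add_zero, Fin.succ_one_eq_two, s2, Nat.mod_succ, Nat.succ_eq_add_one,
    Nat.reduceAdd, zero_add, Matrix.cons_val_one, Matrix.cons_val_zero, t1, Matrix.cons_val, t2]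
  constructor
  · intro h
    refine ⟨⟨fun j => ?_, fun j => ?_, fun j => ?_⟩, fun j => ?_, fun j => ?_, fun j => ?_⟩
    · convert (h (3 * j + 1)).2 using 2 <;> ring
    · convert (h (3 * j)).2 using 2 <;> ring
    · convert (h (3 * j + 2)).2 using 2 <;> ring
    · convert (h (3 * j + 1)).1 using 2 <;> ring
    · convert (h (3 * j)).1 using 2 <;> ring
    · convert (h (3 * j + 2)).1 using 2 <;> ring
  · rintro ⟨⟨h1, h2, h3⟩, h4, h5, h6⟩ n
    obtain ⟨j, rfl | rfl | rfl⟩ : ∃ j, n = 3 * j ∨ n = 3 * j + 1 ∨ n = 3 * j + 2 :=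
      ⟨n / 3, by omega⟩
    · constructor
      · convert h5 j using 2 <;> ring
      · convert h2 j using 2 <;> ring
    · constructor
      · convert h4 j using 2 <;> ring
      · convert h1 j using 2 <;> ring
    · constructor
      · convert h6 j using 2 <;> ring
      · convert h3 j using 2 <;> ring

theorem mainTheorem8 (q : ℂ) (hq : ‖q‖ < 1) :
    Summable (fun n : ℕ => q ^ (n ^ 2) / qPochhammer (q ^ 4) (q ^ 4) n) ∧
    HasSum (fun L : CylindricPartition ![1, 1, 0] => q ^ L.size)
      ((∑' n : ℕ, q ^ (n ^ 2) / qPochhammer (q ^ 4) (q ^ 4) n) *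
        (qPochhammerInf (-q ^ 2) (q ^ 2) / qPochhammerInf q q)) ∧
    HasSum (fun L : CylindricPartition ![2, 1] => q ^ L.size)
      ((∑' n : ℕ, q ^ (n ^ 2) / qPochhammer (q ^ 4) (q ^ 4) n) *
        (qPochhammerInf (-q ^ 2) (q ^ 2) / qPochhammerInf q q)) := by
  have h4 := norm_pow_lt_one hq four_ne_zero
  have h := hasSum_pow_degree_nearlyAntitone hq
  rw [tsum_rogers hq, mul_assoc, ← div_eq_mul_inv] at h
  exact ⟨summable_pow_div_qPochhammer h4 h4 hq _ fun n => Nat.le_self_pow two_ne_zero n,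
    hasSum_pow_size_one_one_zero h, hasSum_pow_size_two_one h⟩
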